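/- Let $V$ be the $\mathbb{Q}$-vector space of finitely supported rational sequences, and let $\mathcal{P}\subset\mathbb{R}^V$ be the set of all seminorms on $V$ (functions $\mu$ with $\mu(u+v)\le\mu(u)+\mu(v)$ and $\mu(qv)=|q|\mu(v)$ for $q\in\mathbb{Q}$), with the topology of pointwise convergence. Each $\mu\in\mathcal{P}$ extends uniquely to a seminorm $\bar\mu$ on the real vector space $c_{00}$ of finitely supported real sequences; let $X_\mu$ be the real Banach space obtained by completing the quotient of $(c_{00},\bar\mu)$ by $\{x\in c_{00}:\bar\mu(x)=0\}$. Let $$\mathcal{P}_\infty=\{\mu\in\mathcal{P}: X_\mu \text{ is infinite-dimensional}\},\qquad \mathcal{B}=\{\mu\in\mathcal{P}_\infty:\bar\mu\text{ is a norm on }c_{00}\},$$ with the subspace topologies. A real Banach space $X$ is called weakly octahedral if for every finite-dimensional subspace $E$ of $X$, every $f\in X^*$ with $\|f\|\le 1$ and every $\varepsilon>0$ there is $y\in X$ with $\|y\|=1$ such that $$\|x+y\|\ge(1-\varepsilon)\bigl(|f(x)|+\|y\|\bigr)\quad\text{for every }x\in E.$$ For $\mathcal{I}\in\{\mathcal{P}_\infty,\mathcal{B}\}$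 let $$\widehat{WOH}_{\mathcal{I}}=\{\mu\in\mathcal{I}: X_\mu\text{ is linearly isometric to a weakly octahedral Banach space}\}.$$ **Theorem.** $\widehat{WOH}_{\mathcal{P}_\infty}$ is an $F_{\sigma\delta}$ subset of $\mathcal{P}_\infty$, and $\widehat{WOH}_{\mathcal{B}}$ is an $F_{\sigma\delta}$ subset of $\mathcal{B}$, where an $F_{\sigma\delta}$ set is a countable intersection of countable unions of closed sets. -/

import Mathlib

noncomputable section

namespace BanachCoding

/-- Rational sequences with finite support. -/
abbrev V : Type := ℕ →₀ ℚ

/-- Real sequences with finite support. -/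
abbrev C00 : Type := ℕ →₀ ℝ

/-- The inclusion of `V` into `c₀₀`. -/
def toC00 (v : V) : C00 := v.mapRange (fun q : ℚ => (q : ℝ)) Rat.cast_zero

/-- The set `𝒫 ⊆ ℝ^V` of all seminorms on the rational vector space `V`.
As a subtype of `V → ℝ` it carries the topology of pointwise convergence. -/
def P : Set (V → ℝ) :=
  {μ | (∀ u v, μ (u + v) ≤ μ u + μ v) ∧ ∀ (q : ℚ) (v : V), μ (q • v) = |(q : ℝ)| * μ v}

@[simp] theorem toC00_apply (v : V) (i : ℕ) : toC00 v i = (v i : ℝ) := rfl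

theorem toC00_zero : toC00 0 = 0 := by ext i; simp

theorem toC00_add (u v : V) : toC00 (u + v) = toC00 u + toC00 v := by ext i; simp

theorem toC00_sub (u v : V) : toC00 (u - v) = toC00 u - toC00 v := by ext i; simp

theorem toC00_smul (q : ℚ) (v : V) : toC00 (q • v) = (q : ℝ) • toC00 v := by ext i; simp

theorem toC00_single (i : ℕ) (q : ℚ) :
    toC00 (Finsupp.single i q) = Finsupp.single i (q : ℝ) := by
  simp [toC00]

namespace P

variable (μ : P)

theorem map_add_le (u v : V) : μ.1 (u + v) ≤ μ.1 u + μ.1 v := μ.2.1 u v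

theorem map_smul (q : ℚ) (v : V) : μ.1 (q • v) = |(q : ℝ)| * μ.1 v := μ.2.2 q v

theorem map_zero : μ.1 0 = 0 := by
  have := map_smul μ 0 0
  simpa using this

theorem map_nonneg (v : V) : 0 ≤ μ.1 v := by
  have h1 := map_smul μ (-1) v
  have h2 := map_add_le μ v ((-1 : ℚ) • v)
  have h3 : v + (-1 : ℚ) • v = 0 := by simp
  rw [h3, map_zero, h1] at h2
  norm_num at h2
  linarith

/-- The weighted `ℓ₁`-seminorm `x ↦ ∑ i, |x i| * μ (e i)` on `c₀₀`. -/
def ell1 (x : C00) : ℝ := x.sum fun i a => |a| * μ.1 (Finsupp.single i 1)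

theorem ell1_eq (x : C00) {s : Finset ℕ} (hs : x.support ⊆ s) :
    ell1 μ x = ∑ i ∈ s, |x i| * μ.1 (Finsupp.single i 1) :=
  Finsupp.sum_of_support_subset x hs _ (by simp)

theorem ell1_nonneg (x : C00) : 0 ≤ ell1 μ x :=
  Finset.sum_nonneg fun _ _ => mul_nonneg (abs_nonneg _) (map_nonneg μ _)

theorem ell1_zero : ell1 μ 0 = 0 := by simp [ell1]

theorem ell1_add_le (x y : C00) : ell1 μ (x + y) ≤ ell1 μ x + ell1 μ y := by
  rw [ell1_eq μ (x + y) (s := x.support ∪ y.support) Finsupp.support_add,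
    ell1_eq μ x (s := x.support ∪ y.support) Finset.subset_union_left,
    ell1_eq μ y (s := x.support ∪ y.support) Finset.subset_union_right,
    ← Finset.sum_add_distrib]
  refine Finset.sum_le_sum fun i _ => ?_
  rw [← add_mul]
  exact mul_le_mul_of_nonneg_right (abs_add_le _ _) (map_nonneg μ _)

theorem ell1_smul (r : ℝ) (x : C00) : ell1 μ (r • x) = |r| * ell1 μ x := by
  rw [ell1_eq μ (r • x) (s := x.support) Finsupp.support_smul, ell1_eq μ x (s := x.support) le_rfl,
    Finset.mul_sum]
  refine Finset.sum_congr rfl fun i _ => ?_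
  simp [abs_mul, mul_assoc]

theorem ell1_single (i : ℕ) (a : ℝ) :
    ell1 μ (Finsupp.single i a) = |a| * μ.1 (Finsupp.single i 1) := by
  simp [ell1]

theorem le_ell1 (v : V) : μ.1 v ≤ ell1 μ (toC00 v) := by
  have key : ∀ s : Finset ℕ, μ.1 (∑ i ∈ s, Finsupp.single i (v i)) ≤
      ∑ i ∈ s, |(v i : ℝ)| * μ.1 (Finsupp.single i 1) := by
    intro s
    induction s using Finset.induction_on with
    | empty => simp [map_zero]
    | insert a s ha ih =>
      rw [Finset.sum_insert ha, Finset.sum_insert ha]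
      refine (map_add_le μ _ _).trans (add_le_add (le_of_eq ?_) ih)
      rw [← map_smul]
      simp
  have h := key v.support
  have h2 : ∑ i ∈ v.support, Finsupp.single i (v i) = v := Finsupp.sum_single v
  rw [h2] at h
  rw [ell1_eq μ (toC00 v) (s := v.support) (by intro i; simp)]
  exact h

/-- `V` is dense in `c₀₀` for the weighted `ℓ₁`-seminorm. -/
theorem exists_ell1_sub_lt (x : C00) {ε : ℝ} (hε : 0 < ε) :
    ∃ v : V, ell1 μ (x - toC00 v) < ε := by
  induction x using Finsupp.induction_linear generalizing ε with
  | zero => exact ⟨0, by simpa [toC00_zero, ell1_zero] using hε⟩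
  | add x y hx hy =>
    obtain ⟨u, hu⟩ := hx (half_pos hε)
    obtain ⟨v, hv⟩ := hy (half_pos hε)
    refine ⟨u + v, ?_⟩
    have : x + y - toC00 (u + v) = (x - toC00 u) + (y - toC00 v) := by
      rw [toC00_add]; abel
    rw [this]
    linarith [ell1_add_le μ (x - toC00 u) (y - toC00 v)]
  | single i a =>
    set m := μ.1 (Finsupp.single i 1) with hm
    have hm0 : 0 ≤ m := map_nonneg μ _
    have hpos : 0 < ε / (m + 1) := by positivity
    obtain ⟨q, hq⟩ := Rat.denseRange_cast (𝕜 := ℝ) |>.exists_dist_lt a hpos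
    refine ⟨Finsupp.single i q, ?_⟩
    rw [toC00_single, ← Finsupp.single_sub, ell1_single, ← hm]
    rw [Real.dist_eq, lt_div_iff₀ (by positivity)] at hq
    nlinarith [abs_nonneg (a - q)]

/-- The value at `x ∈ c₀₀` of the extension `μ̄` of `μ`. -/
def extFun (x : C00) : ℝ := ⨅ v : V, (μ.1 v + ell1 μ (x - toC00 v))

theorem extFun_le (x : C00) (v : V) : extFun μ x ≤ μ.1 v + ell1 μ (x - toC00 v) :=
  ciInf_le ⟨0, by
    rintro _ ⟨w, rfl⟩
    exact add_nonneg (map_nonneg μ w) (ell1_nonneg μ _)⟩ v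

theorem extFun_add_le (x y : C00) : extFun μ (x + y) ≤ extFun μ x + extFun μ y := by
  unfold extFun
  refine le_ciInf_add_ciInf fun u v => ?_
  refine (extFun_le μ (x + y) (u + v)).trans ?_
  have : x + y - toC00 (u + v) = (x - toC00 u) + (y - toC00 v) := by
    rw [toC00_add]; abel
  rw [this]
  linarith [ell1_add_le μ (x - toC00 u) (y - toC00 v), map_add_le μ u v]

theorem extFun_smul_le (r : ℝ) (x : C00) : extFun μ (r • x) ≤ ‖r‖ * extFun μ x := by
  rw [Real.norm_eq_abs]
  conv_rhs => rw [extFun]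
  rw [Real.mul_iInf_of_nonneg (abs_nonneg r)]
  refine le_ciInf fun v => le_of_forall_pos_le_add fun ε hε => ?_
  set c := μ.1 v + ell1 μ (toC00 v) with hc
  have hc0 : 0 ≤ c := add_nonneg (map_nonneg μ v) (ell1_nonneg μ _)
  obtain ⟨s, hs⟩ := Rat.denseRange_cast (𝕜 := ℝ) |>.exists_dist_lt r
    (show 0 < ε / (c + 1) by positivity)
  rw [Real.dist_eq, lt_div_iff₀ (by positivity)] at hs
  have h1 := extFun_le μ (r • x) (s • v)
  have h2 : r • x - toC00 (s • v) = r • (x - toC00 v) + (r - (s : ℝ)) • toC00 v := by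
    rw [toC00_smul]; module
  rw [h2, map_smul] at h1
  have h3 := ell1_add_le μ (r • (x - toC00 v)) ((r - (s : ℝ)) • toC00 v)
  rw [ell1_smul, ell1_smul] at h3
  have h4 : |(s : ℝ)| ≤ |r| + |r - s| := by
    have := abs_sub_abs_le_abs_sub (s : ℝ) r
    rw [abs_sub_comm] at this
    linarith
  have h5 := mul_le_mul_of_nonneg_right h4 (map_nonneg μ v)
  have h6 := abs_nonneg (r - (s : ℝ))
  nlinarith

/-- The extension `μ̄` of `μ` to a (real) seminorm on `c₀₀`; see `ext_unique`. -/
def ext : Seminorm ℝ C00 :=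
  Seminorm.ofSMulLE (extFun μ)
    (le_antisymm (by simpa [toC00_zero, map_zero, ell1_zero] using extFun_le μ 0 0)
      (le_ciInf fun v => add_nonneg (map_nonneg μ v) (ell1_nonneg μ _)))
    (extFun_add_le μ) (extFun_smul_le μ)

theorem ext_apply (x : C00) : ext μ x = ⨅ v : V, (μ.1 v + ell1 μ (x - toC00 v)) := rfl

theorem ext_toC00 (v : V) : ext μ (toC00 v) = μ.1 v := by
  refine le_antisymm ?_ ?_
  · have h := extFun_le μ (toC00 v) v
    rw [sub_self, ell1_zero, add_zero] at h
    exact h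
  · rw [ext_apply]
    refine le_ciInf fun w => ?_
    have h1 := map_add_le μ w (v - w)
    have h2 := le_ell1 μ (v - w)
    rw [toC00_sub] at h2
    rw [add_sub_cancel] at h1
    linarith

theorem ext_le_ell1 (x : C00) : ext μ x ≤ ell1 μ x := by
  have h := extFun_le μ x 0
  rw [toC00_zero, sub_zero, map_zero, zero_add] at h
  exact h

/-- `μ̄` is the only seminorm on `c₀₀` extending `μ`. -/
theorem ext_unique (p : Seminorm ℝ C00) (hp : ∀ v, p (toC00 v) = μ.1 v) : p = ext μ := by
  have hpe : ∀ x, p x ≤ ell1 μ x := by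
    intro x
    induction x using Finsupp.induction with
    | zero => simp [ell1_zero]
    | single_add i a x hi ha ih =>
      have h1 : p (Finsupp.single i a) = |a| * μ.1 (Finsupp.single i 1) := by
        have : (Finsupp.single i a : C00) = a • toC00 (Finsupp.single i 1) := by
          rw [toC00_single]; simp
        rw [this, map_smul_eq_mul, hp, Real.norm_eq_abs]
      have h2 : ell1 μ (Finsupp.single i a + x) =
          |a| * μ.1 (Finsupp.single i 1) + ell1 μ x := by
        unfold ell1
        rw [Finsupp.sum_add_index_of_disjoint, Finsupp.sum_single_index (by simp)]
        rw [Finsupp.support_single _ ha]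
        simpa using hi
      rw [h2, ← h1]
      exact (map_add_le_add p _ _).trans (by linarith)
  ext x
  refine le_antisymm ?_ (le_of_forall_pos_le_add fun ε hε => ?_)
  · rw [ext_apply]
    refine le_ciInf fun v => ?_
    have h := map_add_le_add p (toC00 v) (x - toC00 v)
    rw [add_sub_cancel, hp] at h
    linarith [hpe (x - toC00 v)]
  · obtain ⟨v, hv⟩ := exists_ell1_sub_lt μ x (half_pos hε)
    have h1 := map_add_le_add (ext μ) (toC00 v) (x - toC00 v)
    rw [add_sub_cancel, ext_toC00] at h1
    have h2 := map_sub_le_add p x (x - toC00 v)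
    rw [sub_sub_cancel, hp] at h2
    linarith [hpe (x - toC00 v), ext_le_ell1 μ (x - toC00 v)]

end P

/-- The space `c₀₀` equipped with the seminorm `μ̄`. -/
def PreX (_μ : P) : Type := C00

namespace PreX

variable (μ : P)

instance : AddCommGroup (PreX μ) := inferInstanceAs (AddCommGroup C00)

instance : Module ℝ (PreX μ) := inferInstanceAs (Module ℝ C00)

instance : SeminormedAddCommGroup (PreX μ) :=
  AddGroupSeminorm.toSeminormedAddCommGroup (E := PreX μ) (P.ext μ).toAddGroupSeminorm

theorem norm_def (x : PreX μ) : ‖x‖ = P.ext μ x := rfl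

instance : NormedSpace ℝ (PreX μ) where
  norm_smul_le r x := (map_smul_eq_mul (P.ext μ) r x).le

end PreX

/-- The Banach space `X_μ`: the completion of the quotient of `(c₀₀, μ̄)` by the kernel of `μ̄`. -/
abbrev X (μ : P) : Type := UniformSpace.Completion (SeparationQuotient (PreX μ))

/-- `𝒫_∞`: the seminorms `μ ∈ 𝒫` for which `X_μ` is infinite-dimensional. -/
def PInf : Set P := {μ | ¬ FiniteDimensional ℝ (X μ)}

/-- `ℬ`: the seminorms `μ ∈ 𝒫_∞` whose extension `μ̄` is a norm on `c₀₀`. -/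
def B : Set P := {μ | μ ∈ PInf ∧ ∀ x : C00, P.ext μ x = 0 → x = 0}

/-- The isometry class, in a subspace `I` of `𝒫`, of a property `Q` of Banach spaces: all `μ ∈ I`
such that `X_μ` is linearly isometric to a Banach space with the property `Q`. -/
def isometryClass (Q : (Y : Type) → [NormedAddCommGroup Y] → [NormedSpace ℝ Y] → Prop)
    (I : Set P) : Set I :=
  {μ | ∃ (Y : Type) (_ : NormedAddCommGroup Y) (_ : NormedSpace ℝ Y),
    CompleteSpace Y ∧ Nonempty (X μ.1 ≃ₗᵢ[ℝ] Y) ∧ Q Y}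

/-- Weakly octahedral spaces. -/
def WeaklyOctahedral (Y : Type*) [NormedAddCommGroup Y] [NormedSpace ℝ Y] : Prop :=
  ∀ E : Submodule ℝ Y, FiniteDimensional ℝ E → ∀ f : Y →L[ℝ] ℝ, ‖f‖ ≤ 1 → ∀ ε : ℝ, 0 < ε →
    ∃ y : Y, ‖y‖ = 1 ∧ ∀ x ∈ E, (1 - ε) * (|f x| + ‖y‖) ≤ ‖x + y‖

/-- Countable intersections of countable unions of closed sets. -/
def IsFSigmaDelta {T : Type*} [TopologicalSpace T] (S : Set T) : Prop :=
  ∃ F : ℕ → ℕ → Set T, (∀ i j, IsClosed (F i j)) ∧ S = ⋂ i, ⋃ j, F i j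

end BanachCoding

end

/-! Weak octahedrality is isometry invariant, so the question is for which μ the space `X μ` itself
is weakly octahedral. By density of `V` and compactness of balls in finite-dimensional subspaces,
this reduces to countably many conditions `octahedralOn F δ`, with `F` a finite subset of `V`, δ =
1/(n+1) and the witness y taken in `V`; functionals in the dual unit ball become additive maps f on
`V` with |f| ≤ μ. The remaining quantifier, over uncountably many f, is universal. After the
rescaling f = μ · g, the g range over one compact cube that does not depend on μ, and projection
along a compact factor is closed; so each condition is open (`isOpen_octahedralOn`). The class is
therefore a G_δ, and since 𝒫 is metrizable, an F_σδ. -/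

noncomputable section

namespace BanachCoding

section FSigmaDelta

variable {T : Type*} [TopologicalSpace T]

/-- In a metrizable space a countable intersection of open sets is an `F_σδ` set. -/
theorem isFSigmaDelta_iInter_of_isOpen [TopologicalSpace.MetrizableSpace T] {ι : Type*}
    [Countable ι] [Nonempty ι] {U : ι → Set T} (hU : ∀ i, IsOpen (U i)) :
    IsFSigmaDelta (⋂ i, U i) := by
  let := TopologicalSpace.metrizableSpaceMetric T
  obtain ⟨e, he⟩ := exists_surjective_nat ι
  choose F hF _ hFU _ using fun i => (hU (e i)).exists_iUnion_isClosed
  refine ⟨F, hF, ?_⟩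
  simp only [hFU]
  exact (he.iInter_comp U).symm

end FSigmaDelta

/-! ### Isometry invariance -/

section Isometry

variable {Y Z : Type*} [NormedAddCommGroup Y] [NormedSpace ℝ Y] [NormedAddCommGroup Z]
  [NormedSpace ℝ Z]

theorem WeaklyOctahedral.of_linearIsometryEquiv (hZ : WeaklyOctahedral Z) (e : Y ≃ₗᵢ[ℝ] Z) :
    WeaklyOctahedral Y := by
  intro E hE f hf ε hε
  obtain ⟨z, hz, h⟩ := hZ (E.map e.toLinearEquiv.toLinearMap) inferInstance
    (f.comp (e.symm : Z →L[ℝ] Y))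
    ((f.opNorm_comp_le _).trans (mul_le_one₀ hf (norm_nonneg _)
      e.symm.toLinearIsometry.norm_toContinuousLinearMap_le)) ε hε
  refine ⟨e.symm z, by simpa using hz, fun x hx => ?_⟩
  have h1 := h (e x) (Submodule.mem_map_of_mem hx)
  have h2 : ‖x + e.symm z‖ = ‖e x + z‖ := by
    rw [← e.norm_map, map_add, e.apply_symm_apply]
  rw [h2]
  simpa using h1

theorem mem_isometryClass_weaklyOctahedral (I : Set P) (μ : I) :
    μ ∈ isometryClass (fun Y _ _ => WeaklyOctahedral Y) I ↔ WeaklyOctahedral (X μ.1) :=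
  ⟨fun ⟨_, _, _, _, ⟨e⟩, hY⟩ => hY.of_linearIsometryEquiv e,
    fun h => ⟨X μ.1, _, _, inferInstance, ⟨LinearIsometryEquiv.refl ℝ _⟩, h⟩⟩

end Isometry

/-! ### `V` as a dense part of `X μ`, and its functionals -/

namespace X

variable (μ : P)

/-- The canonical linear map from `c₀₀` to `X_μ`. -/
def ofC00 : C00 →ₗ[ℝ] X μ where
  toFun x := ((SeparationQuotient.mk (show PreX μ from x) : SeparationQuotient (PreX μ)) : X μ)
  map_add' x y := by
    rw [← UniformSpace.Completion.coe_add, ← SeparationQuotient.mk_add]; rfl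
  map_smul' r x := by
    rw [RingHom.id_apply, ← UniformSpace.Completion.coe_smul, ← SeparationQuotient.mk_smul]; rfl

theorem norm_ofC00 (x : C00) : ‖ofC00 μ x‖ = P.ext μ x :=
  (UniformSpace.Completion.norm_coe _).trans (SeparationQuotient.norm_mk _)

theorem denseRange_ofC00 : DenseRange (ofC00 μ) :=
  (UniformSpace.Completion.denseRange_coe (α := SeparationQuotient (PreX μ))).comp
    (SeparationQuotient.surjective_mk (X := PreX μ)).denseRange
    (UniformSpace.Completion.continuous_coe _)

/-- The canonical map from `V` to `X_μ`. -/
def ofV (v : V) : X μ := ofC00 μ (toC00 v)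

theorem ofV_add (u v : V) : ofV μ (u + v) = ofV μ u + ofV μ v := by
  simp only [ofV, toC00_add, map_add]

theorem norm_ofV (v : V) : ‖ofV μ v‖ = μ.1 v := by
  rw [ofV, norm_ofC00, P.ext_toC00]

theorem exists_norm_sub_ofV_lt (x : X μ) {ε : ℝ} (hε : 0 < ε) : ∃ v, ‖x - ofV μ v‖ < ε := by
  obtain ⟨z, hz⟩ := (denseRange_ofC00 μ).exists_dist_lt x (half_pos hε)
  obtain ⟨v, hv⟩ := P.exists_ell1_sub_lt μ z (half_pos hε)
  refine ⟨v, ?_⟩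
  have h := norm_sub_le_norm_sub_add_norm_sub x (ofC00 μ z) (ofV μ v)
  rw [ofV, ← map_sub, norm_ofC00] at h
  rw [dist_eq_norm] at hz
  rw [ofV]
  linarith [P.ext_le_ell1 μ (z - toC00 v)]

/-- Every additive functional on `V` dominated by `μ` extends to a functional of norm at most one
on `X_μ`. -/
theorem exists_extension (f : V →+ ℝ) (hf : ∀ v, |f v| ≤ μ.1 v) :
    ∃ g : X μ →L[ℝ] ℝ, ‖g‖ ≤ 1 ∧ ∀ v, g (ofV μ v) = f v := by
  let F : C00 →ₗ[ℝ] ℝ := Finsupp.linearCombination ℝ fun i => f (Finsupp.single i 1)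
  have hF (v : V) : F (toC00 v) = f v := by
    have : F.toAddMonoidHom.comp ⟨⟨toC00, toC00_zero⟩, toC00_add⟩ = f := by
      refine Finsupp.addHom_ext fun i q => ?_
      -- Additive maps between rational vector spaces are automatically ℚ-linear.
      have h : f (Finsupp.single i q) = q * f (Finsupp.single i 1) := by
        rw [show (Finsupp.single i q : V) = q • Finsupp.single i 1 by simp,
          map_rat_smul f, Rat.smul_def]
      simp [F, toC00_single, h]
    exact DFunLike.congr_fun this v
  have hF1 (x : C00) : |F x| ≤ P.ell1 μ x := by
    rw [P.ell1, Finsupp.linearCombination_apply, Finsupp.sum, Finsupp.sum]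
    refine (Finset.abs_sum_le_sum_abs _ _).trans (Finset.sum_le_sum fun i _ => ?_)
    rw [smul_eq_mul, abs_mul]
    exact mul_le_mul_of_nonneg_left (hf _) (abs_nonneg _)
  -- The norm is an infimum of μ v + `ell1` (x - v), so it suffices to bound `F` on the two summands
  -- of x = v + (x - v) separately.
  have hF2 (x : C00) : ‖F x‖ ≤ 1 * ‖ofC00 μ x‖ := by
    rw [one_mul, norm_ofC00, P.ext_apply, Real.norm_eq_abs]
    refine le_ciInf fun v => ?_
    have h : F x = F (toC00 v) + F (x - toC00 v) := by rw [← map_add, add_sub_cancel]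
    rw [h]
    refine (abs_add_le _ _).trans (add_le_add ?_ (hF1 _))
    rw [hF]
    exact hf v
  refine ⟨F.extendOfNorm (ofC00 μ),
    LinearMap.opNorm_extendOfNorm_le (denseRange_ofC00 μ) zero_le_one hF2, fun v => ?_⟩
  rw [ofV, LinearMap.extendOfNorm_eq (denseRange_ofC00 μ) ⟨1, hF2⟩, hF]

/-- Compact subsets of `X_μ` have finite nets in `V`. -/
theorem exists_finset_net {K : Set (X μ)} (hK : IsCompact K) {δ : ℝ} (hδ : 0 < δ) :
    ∃ F : Finset V, ∀ x ∈ K, ∃ v ∈ F, ‖x - ofV μ v‖ < δ := by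
  obtain ⟨F, hF⟩ := hK.elim_finite_subcover (fun v => Metric.ball (ofV μ v) δ)
    (fun _ => Metric.isOpen_ball) fun x _ => by
      obtain ⟨v, hv⟩ := exists_norm_sub_ofV_lt μ x hδ
      exact Set.mem_iUnion.2 ⟨v, by rwa [Metric.mem_ball, dist_eq_norm]⟩
  refine ⟨F, fun x hx => ?_⟩
  obtain ⟨v, hv, h⟩ := Set.mem_iUnion₂.1 (hF hx)
  exact ⟨v, hv, by rwa [Metric.mem_ball, dist_eq_norm] at h⟩

end X

/-! ### Weak octahedrality as countably many open conditions -/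

/-- The seminorms for which weak octahedrality holds up to `δ` on the finite set `F`. The additive
functionals `f` with `|f| ≤ μ` are written as `μ * g` with `g` in a compact cube. -/
def octahedralOn (F : Finset V) (δ : ℝ) : Set P :=
  {μ | ∀ g : V → Set.Icc (-1 : ℝ) 1,
    (∀ u v, μ.1 (u + v) * g (u + v) = μ.1 u * g u + μ.1 v * g v) →
    ∃ y, |μ.1 y - 1| < δ ∧ ∀ x ∈ F, (1 - δ) * (|μ.1 x * g x| + 1) < μ.1 (x + y)}

theorem mem_octahedralOn_iff {μ : P} {F : Finset V} {δ : ℝ} :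
    μ ∈ octahedralOn F δ ↔ ∀ f : V →+ ℝ, (∀ v, |f v| ≤ μ.1 v) →
      ∃ y, |μ.1 y - 1| < δ ∧ ∀ x ∈ F, (1 - δ) * (|f x| + 1) < μ.1 (x + y) := by
  refine ⟨fun h f hf => ?_, fun h g hg => ?_⟩
  · have hmem (v : V) : f v / μ.1 v ∈ Set.Icc (-1 : ℝ) 1 := by
      rw [Set.mem_Icc, ← abs_le, abs_div, abs_of_nonneg (P.map_nonneg μ v)]
      exact div_le_one_of_le₀ (hf v) (P.map_nonneg μ v)
    -- Where μ v = 0, division gives the value 0, which is harmless because then f v = 0 as well.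
    have hmul (v : V) : μ.1 v * (f v / μ.1 v) = f v := by
      refine mul_div_cancel_of_imp' fun h0 => ?_
      have := hf v
      rw [h0] at this
      exact abs_nonpos_iff.1 this
    simpa only [hmul] using h (fun v => ⟨_, hmem v⟩) (by simp only [hmul]; exact map_add f)
  · refine h (AddMonoidHom.mk' (fun v => μ.1 v * g v) hg) fun v => ?_
    have := abs_le.2 (g v).2
    simpa [abs_mul, abs_of_nonneg (P.map_nonneg μ v)] using
      mul_le_of_le_one_right (P.map_nonneg μ v) this

/-- The complement is the projection of the closed set `C` of pairs (μ, g) with μ · g additive and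
no good y; the cube of all g is compact by Tychonoff, so the projection is closed. Closedness of `C`
uses that the inequalities on y are strict. -/
theorem isOpen_octahedralOn (F : Finset V) (δ : ℝ) : IsOpen (octahedralOn F δ) := by
  have hμ (v : V) : Continuous fun p : P × (V → Set.Icc (-1 : ℝ) 1) => p.1.1 v :=
    (continuous_apply v).comp (continuous_subtype_val.comp continuous_fst)
  have hg (v : V) : Continuous fun p : P × (V → Set.Icc (-1 : ℝ) 1) => ((p.2 v : ℝ)) :=
    continuous_subtype_val.comp ((continuous_apply v).comp continuous_snd)
  have hf (v : V) := (hμ v).mul (hg v)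
  have hO (y : V) : IsOpen {p : P × (V → Set.Icc (-1 : ℝ) 1) | |p.1.1 y - 1| < δ ∧
      ∀ x ∈ F, (1 - δ) * (|p.1.1 x * (p.2 x : ℝ)| + 1) < p.1.1 (x + y)} := by
    have : {p : P × (V → Set.Icc (-1 : ℝ) 1) |
        ∀ x ∈ F, (1 - δ) * (|p.1.1 x * (p.2 x : ℝ)| + 1) < p.1.1 (x + y)} =
        ⋂ x ∈ F, {p | (1 - δ) * (|p.1.1 x * (p.2 x : ℝ)| + 1) < p.1.1 (x + y)} := by
      ext; simp only [Set.mem_ofPred_eq, Set.mem_iInter]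
    rw [Set.ofPred_and, this]
    refine (isOpen_lt ((hμ y).sub continuous_const).abs continuous_const).inter ?_
    exact isOpen_biInter_finset fun x _ =>
      isOpen_lt (continuous_const.mul ((hf x).abs.add continuous_const)) (hμ _)
  let C : Set (P × (V → Set.Icc (-1 : ℝ) 1)) :=
    {p | ∀ u v, p.1.1 (u + v) * p.2 (u + v) = p.1.1 u * p.2 u + p.1.1 v * p.2 v} ∩
    {p | ∀ y, ¬ (|p.1.1 y - 1| < δ ∧
      ∀ x ∈ F, (1 - δ) * (|p.1.1 x * p.2 x| + 1) < p.1.1 (x + y))}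
  have hC : IsClosed C := by
    refine IsClosed.inter ?_ ?_
    · simp only [Set.ofPred_forall]
      exact isClosed_iInter fun u => isClosed_iInter fun v =>
        isClosed_eq (hf _) ((hf _).add (hf _))
    · rw [Set.ofPred_forall]
      exact isClosed_iInter fun y => (hO y).isClosed_compl
  have : octahedralOn F δ = (Prod.fst '' C)ᶜ := by
    ext μ
    refine ⟨fun h ⟨p, hp, hpμ⟩ => ?_, fun h g hg => ?_⟩
    · subst hpμ
      obtain ⟨y, hy⟩ := h p.2 hp.1
      exact hp.2 y hy
    · by_contra hy
      exact h ⟨(μ, g), ⟨hg, not_exists.1 hy⟩, rfl⟩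
  rw [this]
  exact (isClosedMap_fst_of_compactSpace _ hC).isOpen_compl

theorem WeaklyOctahedral.mem_octahedralOn {μ : P} (h : WeaklyOctahedral (X μ)) (F : Finset V)
    {δ : ℝ} (hδ : 0 < δ) : μ ∈ octahedralOn F δ := by
  refine mem_octahedralOn_iff.2 fun f hf => ?_
  obtain ⟨g, hg, hgf⟩ := X.exists_extension μ f hf
  -- Half of δ is kept for moving y into `V`: (1 - δ/2)(|f x| + 1) - δ/2 ≥ (1 - δ)(|f x| + 1).
  obtain ⟨y, hy, hE⟩ := h (Submodule.span ℝ (X.ofV μ '' F))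
    (FiniteDimensional.span_of_finite ℝ (F.finite_toSet.image _)) g hg (δ / 2) (half_pos hδ)
  obtain ⟨v, hv⟩ := X.exists_norm_sub_ofV_lt μ y (half_pos hδ)
  refine ⟨v, ?_, fun x hx => ?_⟩
  · have := abs_norm_sub_norm_le y (X.ofV μ v)
    rw [hy, X.norm_ofV, abs_sub_comm] at this
    linarith
  · have h1 := hE _ (Submodule.subset_span (Set.mem_image_of_mem _ hx))
    rw [hgf, hy] at h1
    have h2 := norm_sub_norm_le (X.ofV μ x + y) (X.ofV μ (x + v))
    rw [X.ofV_add, add_sub_add_left_eq_sub, ← X.ofV_add, X.norm_ofV] at h2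
    nlinarith [abs_nonneg (f x)]

theorem weaklyOctahedral_of_mem_octahedralOn {μ : P}
    (h : ∀ (F : Finset V) (n : ℕ), μ ∈ octahedralOn F (1 / (n + 1))) :
    WeaklyOctahedral (X μ) := by
  intro E hE f hf ε hε
  -- The approximations below cost at most 4δ in all; δ < 1/2 keeps 1 - δ positive and the witness
  -- nonzero, so that it can be normalized.
  obtain ⟨n, hn⟩ := exists_nat_one_div_lt (show 0 < min (ε / 4) (1 / 2) by positivity)
  set δ : ℝ := 1 / (n + 1) with hδ
  have hδ0 : 0 < δ := by positivity
  have hδε : δ < ε / 4 := hn.trans_le (min_le_left _ _)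
  have hδ1 : δ < 1 / 2 := hn.trans_le (min_le_right _ _)
  -- Only a bounded part of `E` needs a net: beyond radius 4/ε the bound ‖x + z‖ ≥ ‖x‖ - 1 already
  -- suffices, since |f x| ≤ ‖x‖.
  have hK : IsCompact (((↑) : E → X μ) '' Metric.closedBall 0 (4 / ε)) :=
    have : ProperSpace E := FiniteDimensional.proper_real E
    (isCompact_closedBall _ _).image continuous_subtype_val
  obtain ⟨F, hF⟩ := X.exists_finset_net μ hK hδ0
  have hfle (x : X μ) : |f x| ≤ ‖x‖ := by simpa using f.le_of_opNorm_le hf x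
  obtain ⟨y, hy, hyF⟩ := mem_octahedralOn_iff.1 (h F n)
    (AddMonoidHom.mk' (fun v => f (X.ofV μ v)) fun u v => by rw [X.ofV_add, map_add])
    fun v => (hfle _).trans_eq (X.norm_ofV μ v)
  simp only [AddMonoidHom.mk'_apply, ← hδ] at hy hyF
  rw [← X.norm_ofV] at hy
  have hpos : 0 < ‖X.ofV μ y‖ := by linarith [(abs_lt.1 hy).1]
  set z : X μ := ‖X.ofV μ y‖⁻¹ • X.ofV μ y with hz
  have hz1 : ‖z‖ = 1 := by
    rw [hz, norm_smul, norm_inv, norm_norm, inv_mul_cancel₀ hpos.ne']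
  have hzy : ‖z - X.ofV μ y‖ < δ := by
    have : X.ofV μ y = ‖X.ofV μ y‖ • z := by rw [hz, smul_inv_smul₀ hpos.ne']
    calc ‖z - X.ofV μ y‖ = ‖(1 - ‖X.ofV μ y‖) • z‖ := by rw [sub_smul, one_smul, ← this]
      _ = |‖X.ofV μ y‖ - 1| := by rw [norm_smul, hz1, mul_one, Real.norm_eq_abs, abs_sub_comm]
      _ < δ := hy
  refine ⟨z, hz1, fun x hx => ?_⟩
  rw [hz1]
  have hfx := hfle x
  have hfx0 := abs_nonneg (f x)
  rcases le_or_gt ‖x‖ (4 / ε) with hxR | hxR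
  · obtain ⟨v, hv, hxv⟩ := hF x ⟨⟨x, hx⟩, by simpa using hxR, rfl⟩
    have h1 := hyF v hv
    rw [← X.norm_ofV, X.ofV_add] at h1
    have h2 : ‖X.ofV μ v + X.ofV μ y‖ ≤ ‖x + z‖ + ‖x - X.ofV μ v‖ + ‖z - X.ofV μ y‖ := by
      have : X.ofV μ v + X.ofV μ y = x + z - (x - X.ofV μ v) - (z - X.ofV μ y) := by abel
      rw [this]
      exact (norm_sub_le _ _).trans (add_le_add_left (norm_sub_le _ _) _)
    have h3 : |f x| ≤ |f (X.ofV μ v)| + ‖x - X.ofV μ v‖ := by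
      have := hfle (x - X.ofV μ v)
      rw [map_sub] at this
      linarith [abs_sub_abs_le_abs_sub (f x) (f (X.ofV μ v))]
    have h4 : (1 - δ) * (|f x| - δ) ≤ (1 - δ) * |f (X.ofV μ v)| :=
      mul_le_mul_of_nonneg_left (by linarith) (by linarith)
    nlinarith
  · have h1 := norm_sub_le_norm_add x z
    rw [hz1] at h1
    rw [div_lt_iff₀ hε] at hxR
    rcases le_or_gt ε 1 with h | h <;> nlinarith [norm_nonneg (x + z)]

theorem weaklyOctahedral_X_iff (μ : P) :
    WeaklyOctahedral (X μ) ↔ ∀ p : Finset V × ℕ, μ ∈ octahedralOn p.1 (1 / (p.2 + 1)) :=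
  ⟨fun h p => h.mem_octahedralOn p.1 (by positivity),
    fun h => weaklyOctahedral_of_mem_octahedralOn fun F n => h (F, n)⟩

theorem isFSigmaDelta_isometryClass_weaklyOctahedral (I : Set P) :
    IsFSigmaDelta (isometryClass (fun Y _ _ => WeaklyOctahedral Y) I) := by
  have : isometryClass (fun Y _ _ => WeaklyOctahedral Y) I =
      ⋂ p : Finset V × ℕ, ((↑) : I → P) ⁻¹' octahedralOn p.1 (1 / (p.2 + 1)) := by
    ext μ
    rw [mem_isometryClass_weaklyOctahedral, weaklyOctahedral_X_iff, Set.mem_iInter]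
    rfl
  rw [this]
  -- `V` is countable, so ℝ^V is second countable.
  have : TopologicalSpace.MetrizableSpace (V → ℝ) :=
    TopologicalSpace.metrizableSpace_of_t3_secondCountable _
  exact isFSigmaDelta_iInter_of_isOpen fun p =>
    (isOpen_octahedralOn _ _).preimage continuous_subtype_val

end BanachCoding

end

theorem mainTheorem12 :
    BanachCoding.IsFSigmaDelta
        (BanachCoding.isometryClass (fun Y _ _ => BanachCoding.WeaklyOctahedral Y)
          BanachCoding.PInf) ∧
      BanachCoding.IsFSigmaDelta
        (BanachCoding.isometryClass (fun Y _ _ => BanachCoding.WeaklyOctahedral Y)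
          BanachCoding.B) :=
  ⟨BanachCoding.isFSigmaDelta_isometryClass_weaklyOctahedral _,
    BanachCoding.isFSigmaDelta_isometryClass_weaklyOctahedral _⟩
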